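/- Let $\mathbb{N}=\{1,2,3,\dots\}$ and let $a,b\in\mathbb{R}$. Let $V(n)=b$ if $n$ is prime and $V(n)=a$ if $n$ is not prime, and let $H$ be the prime Schrödinger operator, i.e. the bounded operator on $\ell^2(\mathbb{N})$ given by $$(H\phi)(n)=\phi(n+1)+\phi(n-1)+V(n)\phi(n),\qquad n\ge 1,$$ with the Dirichlet boundary condition $\phi(0)=0$. Let $\delta_n$ denote the standard unit vectors of $\ell^2(\mathbb{N})$, and for $T>0$ put $$a(n,T)=\frac1T\int_0^\infty e^{-2t/T}\,\bigl|\langle\delta_n,e^{-itH}\delta_1\rangle\bigr|^2\,dt .$$ For $p>0$ let $$\langle|X|^p_{\delta_1}\rangle(T)=\sum_{n\ge1}n^p\,a(n,T),\qquad \beta^-_{\delta_1}(p)=\liminf_{T\to+\infty}\frac{\log\,\langle|X|^p_{\delta_1}\rangle(T)}{\log T}.$$ Then, for all $a,b\in\mathbb{R}$, $$\beta^-_{\delta_1}(p)\ \ge\ \frac{p-5}{2}\qquad\text{for every } p>0 .$$ -/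

import Mathlib

open scoped ENNReal

/-- The Hilbert space `ℓ²(ℕ)` with `ℕ = {1, 2, 3, …}`, complex valued. -/
abbrev EllTwo : Type := lp (fun _ : ℕ+ => ℂ) 2

/-- The unit vector `δ_n`. -/
noncomputable def delta (n : ℕ+) : EllTwo := lp.single 2 n (1 : ℂ)

/-- The formal Schrödinger operator on the half-line: `φ(n+1) + φ(n-1) + V(n) φ(n)`, with the
Dirichlet boundary condition `φ(0) = 0`. -/
noncomputable def schrodingerFun (V : ℕ+ → ℝ) (φ : ℕ+ → ℂ) (n : ℕ+) : ℂ :=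
  φ (n + 1) + (if n = 1 then 0 else φ (n - 1)) + (V n : ℂ) * φ n

theorem memEllTwo_iff (f : ℕ+ → ℂ) :
    Memℓp (E := fun _ : ℕ+ => ℂ) f 2 ↔ Summable fun n => ‖f n‖ ^ 2 := by
  rw [memℓp_gen_iff (by norm_num)]
  simp

theorem schrodingerFun_mem (V : ℕ+ → ℝ) (hV : ∃ C : ℝ, ∀ n, |V n| ≤ C) (φ : EllTwo) :
    Memℓp (E := fun _ : ℕ+ => ℂ) (schrodingerFun V φ) 2 := by
  obtain ⟨C, hC⟩ := hV
  have h0 := (memEllTwo_iff _).1 (lp.memℓp φ)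
  refine Memℓp.add (f := fun n : ℕ+ => φ (n + 1) + (if n = 1 then 0 else φ (n - 1)))
    (Memℓp.add (f := fun n : ℕ+ => φ (n + 1)) ?_ ?_) ?_
  · rw [memEllTwo_iff]
    exact h0.comp_injective (i := fun n : ℕ+ => n + 1) (add_left_injective 1)
  · rw [memEllTwo_iff]
    have hinj : Function.Injective (fun n : ℕ+ => n + 1) := add_left_injective 1
    refine (Function.Injective.summable_iff hinj ?_).1 ?_
    · intro n hn
      have : n = 1 := by
        by_contra h
        exact hn ⟨n - 1, PNat.sub_add_of_lt (lt_of_le_of_ne one_le (Ne.symm h))⟩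
      simp [this]
    · refine h0.congr fun n => ?_
      have h1 : n + 1 ≠ 1 := (PNat.lt_add_left 1 n).ne'
      have h2 : n + 1 - 1 = n := PNat.add_sub
      simp [h1, h2]
  · rw [memEllTwo_iff]
    refine Summable.of_nonneg_of_le (fun n => by positivity) (fun n => ?_) (h0.mul_left (C ^ 2))
    rw [norm_mul, mul_pow, Complex.norm_real, Real.norm_eq_abs]
    have := hC n
    gcongr

/-- The Schrödinger operator as a linear map on `ℓ²(ℕ)`, for a bounded potential. -/
noncomputable def schrodingerLin (V : ℕ+ → ℝ) (hV : ∃ C : ℝ, ∀ n, |V n| ≤ C) :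
    EllTwo →ₗ[ℂ] EllTwo where
  toFun φ := ⟨schrodingerFun V φ, schrodingerFun_mem V hV φ⟩
  map_add' φ ψ := by
    ext n
    simp only [schrodingerFun, lp.coeFn_add, Pi.add_apply]
    split_ifs <;> ring
  map_smul' c φ := by
    ext n
    simp only [schrodingerFun, lp.coeFn_smul, Pi.smul_apply, smul_eq_mul, RingHom.id_apply]
    split_ifs <;> ring

theorem continuous_coord (n : ℕ+) : Continuous fun φ : EllTwo => φ n :=
  (continuous_apply n).comp (lp.uniformContinuous_coe (E := fun _ : ℕ+ => ℂ) (p := 2)).continuous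

/-- The bounded Schrödinger operator `H` on `ℓ²(ℕ)` with bounded potential `V`,
`(H φ)(n) = φ(n+1) + φ(n-1) + V(n) φ(n)`, `φ(0) = 0`. -/
noncomputable def schrodinger (V : ℕ+ → ℝ) (hV : ∃ C : ℝ, ∀ n, |V n| ≤ C) :
    EllTwo →L[ℂ] EllTwo :=
  ContinuousLinearMap.ofSeqClosedGraph (g := schrodingerLin V hV) <| by
    intro u x y hu hgu
    ext n
    refine tendsto_nhds_unique (((continuous_coord n).tendsto y).comp hgu) ?_
    have hc : Continuous fun φ : EllTwo => schrodingerFun V φ n := by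
      unfold schrodingerFun
      split_ifs
      · exact ((continuous_coord _).add continuous_const).add
          (continuous_const.mul (continuous_coord _))
      · exact ((continuous_coord _).add (continuous_coord _)).add
          (continuous_const.mul (continuous_coord _))
    exact (hc.tendsto x).comp hu

theorem schrodinger_apply (V : ℕ+ → ℝ) (hV : ∃ C : ℝ, ∀ n, |V n| ≤ C) (φ : EllTwo) (n : ℕ+) :
    schrodinger V hV φ n = φ (n + 1) + (if n = 1 then 0 else φ (n - 1)) + (V n : ℂ) * φ n :=
  rfl

/-- The time evolution `ψ(t) = exp(-itH) ψ` (norm-convergent exponential of a bounded operator). -/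
noncomputable def evolution (H : EllTwo →L[ℂ] EllTwo) (ψ : EllTwo) (t : ℝ) : EllTwo :=
  NormedSpace.exp ((-(Complex.I * (t : ℂ))) • H) ψ

/-- `a(n,T) = (1/T) ∫_0^∞ e^{-2t/T} |⟨δ_n, ψ(t)⟩|² dt`, as an extended nonnegative number. -/
noncomputable def avgProb (H : EllTwo →L[ℂ] EllTwo) (ψ : EllTwo) (n : ℕ+) (T : ℝ) : ℝ≥0∞ :=
  ENNReal.ofReal (1 / T) * ∫⁻ t in Set.Ioi (0 : ℝ),
    ENNReal.ofReal (Real.exp (-2 * t / T) * ‖inner ℂ (delta n) (evolution H ψ t)‖ ^ 2)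

/-- The time-averaged moment `⟨|X|_ψ^p⟩(T) = ∑_n n^p a(n,T)`, with values in `[0,∞]`. -/
noncomputable def avgMoment (H : EllTwo →L[ℂ] EllTwo) (ψ : EllTwo) (p T : ℝ) : ℝ≥0∞ :=
  ∑' n : ℕ+, ENNReal.ofReal ((n : ℝ) ^ p) * avgProb H ψ n T

/-- The lower growth exponent `β⁻_ψ(p) = liminf_{T → ∞} log ⟨|X|_ψ^p⟩(T) / log T`, with values in
`[-∞,∞]`. -/
noncomputable def lowerGrowthExponent (H : EllTwo →L[ℂ] EllTwo) (ψ : EllTwo) (p : ℝ) : EReal :=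
  Filter.liminf (fun T : ℝ => ENNReal.log (avgMoment H ψ p T) / (Real.log T : EReal)) Filter.atTop

/-- The prime potential: `b` at the primes, `a` elsewhere. -/
noncomputable def primePotential (a b : ℝ) (n : ℕ+) : ℝ :=
  if (n : ℕ).Prime then b else a

theorem primePotential_bounded (a b : ℝ) : ∃ C : ℝ, ∀ n, |primePotential a b n| ≤ C := by
  refine ⟨max |a| |b|, fun n => ?_⟩
  unfold primePotential
  split_ifs
  · exact le_max_right _ _
  · exact le_max_left _ _

/-- The prime Schrödinger operator on `ℓ²(ℕ)`. -/
noncomputable def primeSchrodinger (a b : ℝ) : EllTwo →L[ℂ] EllTwo :=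
  schrodinger (primePotential a b) (primePotential_bounded a b)

/-! At energy `a` the coefficient `z - V n` of the resolvent recurrence nearly vanishes at every
non-prime site, in particular at every even site beyond `2`. Backward transfer then nearly preserves
the odd entries up to sign and adds to each even entry a bounded multiple of an odd one, like a
product of shears. Hence growth is at most linear, whatever the distribution of the primes among the
odd numbers.

For `z = a + 2i/T` the even coefficients have size `2/T`, harmless up to distance `N ~ √T`:
weighting odd entries by `N` makes each step cost a factor `1 + C/N` (`parityWeight_step`), so
`O(N)` steps cost a constant. The Laplace transform `g` of the evolution solves this recurrence with
`g 0 = i`, so `‖g n‖ + ‖g (n + 1)‖ ≳ 1/N` for `N ≤ n < 2N`.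

Cauchy–Schwarz in time at this single energy gives `a(n,T) ≥ (2/T²)‖g n‖²` (`ofReal_le_avgProb`).
Summing over the window, the moment is at least of order `N^p · N · T⁻² · N⁻² ~ T^((p-5)/2)`. -/

/-! ### Linear bounds for the parity-structured recurrence -/

/-- A norm of `(g n, g (n + 1))` that weights the entry of odd index by `N`. -/
noncomputable def parityWeight (N : ℝ) (g : ℕ → ℂ) (n : ℕ) : ℝ :=
  if Even n then N * ‖g (n + 1)‖ + ‖g n‖ else ‖g (n + 1)‖ + N * ‖g n‖

theorem parityWeight_nonneg {N : ℝ} (hN : 0 ≤ N) (g : ℕ → ℂ) (n : ℕ) :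
    0 ≤ parityWeight N g n := by
  unfold parityWeight; split_ifs <;> positivity

theorem parityWeight_le {N : ℝ} (hN : 1 ≤ N) (g : ℕ → ℂ) (n : ℕ) :
    parityWeight N g n ≤ N * (‖g n‖ + ‖g (n + 1)‖) := by
  have h1 := norm_nonneg (g n)
  have h2 := norm_nonneg (g (n + 1))
  unfold parityWeight; split_ifs <;> nlinarith

theorem norm_le_of_recurrence {x y w c : ℂ} {C : ℝ} (h : x + y = c * w) (hc : ‖c‖ ≤ C) :
    ‖y‖ ≤ ‖x‖ + C * ‖w‖ := by
  have : y = c * w - x := by rw [← h]; ring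
  rw [this, add_comm]
  refine (norm_sub_le _ _).trans ?_
  rw [norm_mul]
  gcongr

/-- One backward step of the recurrence multiplies the weighted norm by at most `1 + C / N`. -/
theorem parityWeight_step {N C η : ℝ} (hN : 1 ≤ N) (hη : η * N ^ 2 ≤ C)
    {g c : ℕ → ℂ} {n : ℕ} (hrec : g (n + 2) + g n = c (n + 1) * g (n + 1))
    (hodd : Odd (n + 1) → ‖c (n + 1)‖ ≤ C) (heven : Even (n + 1) → ‖c (n + 1)‖ ≤ η) :
    parityWeight N g n ≤ (1 + C / N) * parityWeight N g (n + 1) := by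
  have hN0 : 0 < N := by linarith
  have h1 := norm_nonneg (g n)
  have h2 := norm_nonneg (g (n + 1))
  have h3 := norm_nonneg (g (n + 2))
  rcases Nat.even_or_odd n with h | h
  -- The large coefficient multiplies `g (n + 1)`, whose weight `N` absorbs it at relative cost `C /
  -- N`.
  · have ho : Odd (n + 1) := h.add_one
    have hne : ¬ Even (n + 1) := Nat.not_even_iff_odd.2 ho
    have hC : 0 ≤ C := (norm_nonneg _).trans (hodd ho)
    have := norm_le_of_recurrence hrec (hodd ho)
    simp only [parityWeight, h, hne, if_true, if_false]
    have e : (1 + C / N) * (‖g (n + 1 + 1)‖ + N * ‖g (n + 1)‖)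
        = ‖g (n + 2)‖ + N * ‖g (n + 1)‖ + C * ‖g (n + 1)‖ + C / N * ‖g (n + 2)‖ := by
      field_simp; ring
    have : 0 ≤ C / N * ‖g (n + 2)‖ := by positivity
    linarith
  -- Now `g n` carries the weight `N`, but the coefficient is at most `η`, and `N * η ≤ C / N`.
  · have he : Even (n + 1) := h.add_one
    have hne : ¬ Even n := Nat.not_even_iff_odd.2 h
    have hη0 : 0 ≤ η := (norm_nonneg _).trans (heven he)
    have hC : 0 ≤ C := le_trans (by positivity) hη
    have := norm_le_of_recurrence hrec (heven he)
    simp only [parityWeight, he, hne, if_true, if_false]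
    have hηN : N * η ≤ C / N := by
      rw [le_div_iff₀ hN0]; nlinarith
    have e : (1 + C / N) * (N * ‖g (n + 1 + 1)‖ + ‖g (n + 1)‖)
        = N * ‖g (n + 2)‖ + ‖g (n + 1)‖ + C * ‖g (n + 2)‖ + C / N * ‖g (n + 1)‖ := by
      field_simp; ring
    have h4 : N * ‖g n‖ ≤ N * (‖g (n + 2)‖ + η * ‖g (n + 1)‖) := by gcongr
    have h5 := mul_le_mul_of_nonneg_right hηN h2
    have : 0 ≤ C * ‖g (n + 2)‖ := by positivity
    nlinarith

/-- Solutions of a recurrence whose coefficients at even sites beyond `2` are `O(N⁻²)` decay at most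
linearly up to `2 N`. -/
theorem norm_le_of_parity_recurrence {N C η : ℝ} (hN : 1 ≤ N) (hη : η * N ^ 2 ≤ C)
    {g c : ℕ → ℂ} (hrec : ∀ n, g (n + 2) + g n = c (n + 1) * g (n + 1))
    (hc : ∀ n, ‖c n‖ ≤ C) (heven : ∀ n, 2 < n → Even n → ‖c n‖ ≤ η)
    {n : ℕ} (hn : 2 ≤ n) (hnN : n ≤ 2 * N) :
    ‖g 0‖ ≤ (1 + C) ^ 2 * Real.exp (2 * C) * (N * (‖g n‖ + ‖g (n + 1)‖)) := by
  have hN0 : 0 < N := by linarith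
  have hC : 0 ≤ C := (norm_nonneg _).trans (hc 0)
  -- The descent stops at index `2`: the coefficient at the even site `2` need not be small.
  have key : ∀ k : ℕ, parityWeight N g 2 ≤ (1 + C / N) ^ k * parityWeight N g (2 + k) := by
    intro k
    induction k with
    | zero => simp
    | succ k ih =>
      refine ih.trans ?_
      rw [pow_succ, mul_assoc]
      gcongr
      exact parityWeight_step hN hη (hrec _) (fun _ => hc _) (heven _ (by omega))
  obtain ⟨k, rfl⟩ := Nat.exists_eq_add_of_le hn
  have hW := parityWeight_nonneg hN0.le g (2 + k)
  have hpow : (1 + C / N) ^ k ≤ Real.exp (2 * C) := by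
    calc (1 + C / N) ^ k ≤ Real.exp (C / N) ^ k := by
          gcongr; rw [add_comm]; exact Real.add_one_le_exp _
      _ = Real.exp (k * (C / N)) := by rw [← Real.exp_nat_mul]
      _ ≤ Real.exp (2 * C) := by
          push_cast at hnN
          rw [Real.exp_le_exp, mul_div_assoc', div_le_iff₀ hN0]
          nlinarith
  have hW2 : parityWeight N g 2 ≤ Real.exp (2 * C) * (N * (‖g (2 + k)‖ + ‖g (2 + k + 1)‖)) :=
    (key k).trans (by
      gcongr
      exact parityWeight_le hN g _)
  -- The two remaining steps, across sites `2` and `1`, are bounded crudely and produce `(1 + C) ^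
  -- 2`.
  have h0 := norm_le_of_recurrence (hrec 0) (hc _)
  have h1 := norm_le_of_recurrence (hrec 1) (hc _)
  have h2 : N * ‖g 3‖ + ‖g 2‖ = parityWeight N g 2 := by simp [parityWeight]
  simp only [zero_add, Nat.reduceAdd] at h0 h1
  have p2 := norm_nonneg (g 2)
  have p3 := norm_nonneg (g 3)
  have h3 : ‖g 3‖ + ‖g 2‖ ≤ parityWeight N g 2 := by rw [← h2]; nlinarith
  rw [mul_assoc]
  refine le_trans ?_ (mul_le_mul_of_nonneg_left hW2 (by positivity))
  nlinarith [mul_le_mul_of_nonneg_left h1 hC, mul_nonneg hC p2, mul_nonneg hC p3,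
    mul_nonneg (mul_nonneg hC hC) p3, mul_le_mul_of_nonneg_left h3 hC,
    mul_le_mul_of_nonneg_left h3 (mul_nonneg hC hC)]

/-! ### Self-adjointness and unitary evolution -/

theorem inner_delta (n : ℕ+) (φ : EllTwo) : inner ℂ (delta n) φ = φ n := by
  simp [delta, lp.inner_single_left]

theorem tsum_shift (x y : ℕ+ → ℂ) :
    ∑' n : ℕ+, inner ℂ (x (n + 1)) (y n) =
      ∑' n : ℕ+, inner ℂ (x n) (if n = 1 then 0 else y (n - 1)) := by
  have hinj : Function.Injective (fun n : ℕ+ => n + 1) := add_left_injective 1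
  rw [← hinj.tsum_eq (f := fun n : ℕ+ => inner ℂ (x n) (if n = 1 then 0 else y (n - 1)))]
  · refine tsum_congr fun n => ?_
    have h1 : n + 1 ≠ 1 := (PNat.lt_add_left 1 n).ne'
    have h2 : n + 1 - 1 = n := PNat.add_sub
    simp [h1, h2]
  · intro n hn
    have h : n ≠ 1 := by
      rintro rfl
      simp at hn
    exact ⟨n - 1, PNat.sub_add_of_lt (lt_of_le_of_ne one_le (Ne.symm h))⟩

theorem memEllTwo_shift (x : EllTwo) :
    Memℓp (E := fun _ : ℕ+ => ℂ) (fun n : ℕ+ => x (n + 1)) 2 := by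
  rw [memEllTwo_iff]
  exact ((memEllTwo_iff _).1 (lp.memℓp x)).comp_injective (i := fun n : ℕ+ => n + 1)
    (add_left_injective 1)

theorem memEllTwo_shift_right (x : EllTwo) :
    Memℓp (E := fun _ : ℕ+ => ℂ) (fun n : ℕ+ => if n = 1 then 0 else x (n - 1)) 2 := by
  -- The right shift is the free operator minus the left shift.
  have h := schrodingerFun_mem (fun _ => 0) ⟨0, by simp⟩ x
  convert h.sub (memEllTwo_shift x) using 1
  ext n
  simp [schrodingerFun]

theorem memEllTwo_mul (V : ℕ+ → ℝ) (hV : ∃ C : ℝ, ∀ n, |V n| ≤ C) (x : EllTwo) :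
    Memℓp (E := fun _ : ℕ+ => ℂ) (fun n : ℕ+ => (V n : ℂ) * x n) 2 := by
  have h := schrodingerFun_mem V hV x
  convert h.sub (schrodingerFun_mem (fun _ => 0) ⟨0, by simp⟩ x) using 1
  ext n
  simp [schrodingerFun]

theorem isSelfAdjoint_schrodinger (V : ℕ+ → ℝ) (hV : ∃ C : ℝ, ∀ n, |V n| ≤ C) :
    IsSelfAdjoint (schrodinger V hV) := by
  rw [ContinuousLinearMap.isSelfAdjoint_iff_isSymmetric]
  have split : ∀ x y : EllTwo, inner ℂ x (schrodinger V hV y) =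
      ∑' n : ℕ+, inner ℂ (x n) (y (n + 1)) +
      ∑' n : ℕ+, inner ℂ (x n) (if n = 1 then 0 else y (n - 1)) +
      ∑' n : ℕ+, inner ℂ (x n) ((V n : ℂ) * y n) := by
    intro x y
    have h : schrodinger V hV y = (⟨_, memEllTwo_shift y⟩ : EllTwo) +
        (⟨_, memEllTwo_shift_right y⟩ : EllTwo) + (⟨_, memEllTwo_mul V hV y⟩ : EllTwo) := by
      ext n
      rw [schrodinger_apply]
      rfl
    rw [h, inner_add_right, inner_add_right, lp.inner_eq_tsum, lp.inner_eq_tsum, lp.inner_eq_tsum]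
  intro x y
  change inner ℂ (schrodinger V hV x) y = inner ℂ x (schrodinger V hV y)
  rw [← inner_conj_symm, split, split, map_add, map_add, Complex.conj_tsum, Complex.conj_tsum,
    Complex.conj_tsum]
  simp only [inner_conj_symm]
  rw [tsum_shift, add_comm (∑' n, inner ℂ (x n) (y (n + 1)))]
  congr 2
  · have := congrArg (starRingEnd ℂ) (tsum_shift y x)
    rw [Complex.conj_tsum, Complex.conj_tsum] at this
    simpa only [inner_conj_symm] using this.symm
  · funext n
    simp only [RCLike.inner_apply, map_mul, Complex.conj_ofReal]
    ring

theorem norm_evolution {H : EllTwo →L[ℂ] EllTwo} (hH : IsSelfAdjoint H) (ψ : EllTwo) (t : ℝ) :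
    ‖evolution H ψ t‖ = ‖ψ‖ := by
  have ht : IsSelfAdjoint (((-t : ℝ) : ℂ)) := Complex.conj_ofReal _
  have hu := (selfAdjoint.expUnitary ⟨((-t : ℝ) : ℂ) • H, ht.smul hH⟩).2
  rw [selfAdjoint.expUnitary_coe] at hu
  have e : (-(Complex.I * (t : ℂ))) • H = Complex.I • (((-t : ℝ) : ℂ) • H) := by
    rw [smul_smul]
    congr 1
    push_cast; ring
  unfold evolution
  rw [e]
  exact ContinuousLinearMap.norm_map_of_mem_unitary hu ψ

theorem hasDerivAt_evolution (H : EllTwo →L[ℂ] EllTwo) (ψ : EllTwo) (t : ℝ) :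
    HasDerivAt (evolution H ψ) (-Complex.I • H (evolution H ψ t)) t := by
  have h := hasDerivAt_exp_smul_const' (𝕂 := ℂ) (-Complex.I • H) (t : ℂ)
  have h2 := (h.clm_apply (hasDerivAt_const (t : ℂ) ψ)).scomp t Complex.ofRealCLM.hasDerivAt
  simp only [map_zero, add_zero, Complex.ofRealCLM_apply, Complex.ofReal_one, one_smul] at h2
  have e : ∀ s : ℝ, (-(Complex.I * (s : ℂ))) • H = (s : ℂ) • (-Complex.I • H) := by
    intro s
    rw [smul_smul]
    congr 1
    ring
  unfold evolution
  simp only [e]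
  exact h2

/-! ### Laplace transform of the evolution -/

open MeasureTheory Set in
/-- The half-line Fourier–Laplace transform `∫_0^∞ e^{izt} ψ_n(t) dt` of the evolution. -/
noncomputable def evolutionTransform (H : EllTwo →L[ℂ] EllTwo) (ψ : EllTwo) (z : ℂ) (n : ℕ+) : ℂ :=
  ∫ t in Ioi (0 : ℝ), Complex.exp (Complex.I * z * t) * evolution H ψ t n

theorem hasDerivAt_evolution_coord (H : EllTwo →L[ℂ] EllTwo) (ψ : EllTwo) (n : ℕ+) (t : ℝ) :
    HasDerivAt (fun s => evolution H ψ s n) (-Complex.I * H (evolution H ψ t) n) t := by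
  have h := ((innerSL ℂ (delta n)).restrictScalars ℝ).hasFDerivAt.comp_hasDerivAt t
    (hasDerivAt_evolution H ψ t)
  simpa [Function.comp_def, inner_delta, inner_neg_right, inner_smul_right] using h

theorem continuous_evolution_coord (H : EllTwo →L[ℂ] EllTwo) (ψ : EllTwo) (n : ℕ+) :
    Continuous fun t => evolution H ψ t n :=
  continuous_iff_continuousAt.2 fun t => (hasDerivAt_evolution_coord H ψ n t).continuousAt

theorem norm_evolution_coord_le {H : EllTwo →L[ℂ] EllTwo} (hH : IsSelfAdjoint H) (ψ : EllTwo)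
    (n : ℕ+) (t : ℝ) : ‖evolution H ψ t n‖ ≤ ‖ψ‖ := by
  rw [← norm_evolution hH ψ t]
  exact lp.norm_apply_le_norm (by norm_num) _ _

theorem norm_exp_I_mul (z : ℂ) (t : ℝ) :
    ‖Complex.exp (Complex.I * z * t)‖ = Real.exp (-z.im * t) := by
  rw [Complex.norm_exp]
  congr 1
  simp

open MeasureTheory Set in
theorem integrableOn_evolutionTransform {H : EllTwo →L[ℂ] EllTwo} (hH : IsSelfAdjoint H)
    (ψ : EllTwo) {z : ℂ} (hz : 0 < z.im) (n : ℕ+) :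
    IntegrableOn (fun t : ℝ => Complex.exp (Complex.I * z * t) * evolution H ψ t n) (Ioi 0) := by
  refine Integrable.mono' ((integrableOn_exp_mul_Ioi (neg_lt_zero.2 hz) 0).mul_const ‖ψ‖) ?_ ?_
  · have := continuous_evolution_coord H ψ n
    exact Continuous.aestronglyMeasurable (by fun_prop)
  · refine Filter.Eventually.of_forall fun t => ?_
    rw [norm_mul, norm_exp_I_mul]
    gcongr
    exact norm_evolution_coord_le hH ψ n t

open MeasureTheory Set in
/-- The transform solves the resolvent equation `(H - z) g = -i ψ` coordinatewise. -/
theorem schrodingerFun_evolutionTransform (V : ℕ+ → ℝ) (hV : ∃ C : ℝ, ∀ n, |V n| ≤ C)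
    (ψ : EllTwo) {z : ℂ} (hz : 0 < z.im) (n : ℕ+) :
    schrodingerFun V (evolutionTransform (schrodinger V hV) ψ z) n =
      z * evolutionTransform (schrodinger V hV) ψ z n - Complex.I * ψ n := by
  set H := schrodinger V hV with hHdef
  have hH : IsSelfAdjoint H := isSelfAdjoint_schrodinger V hV
  have hint := fun m => integrableOn_evolutionTransform hH ψ hz m
  have hexp : ∀ t : ℝ, Complex.exp (Complex.I * z * t) * H (evolution H ψ t) n =
      Complex.exp (Complex.I * z * t) * evolution H ψ t (n + 1) +
      (if n = 1 then 0 else Complex.exp (Complex.I * z * t) * evolution H ψ t (n - 1)) +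
      (V n : ℂ) * (Complex.exp (Complex.I * z * t) * evolution H ψ t n) := by
    intro t
    rw [hHdef, schrodinger_apply]
    split_ifs <;> ring
  have hif : IntegrableOn (fun t : ℝ => if n = 1 then (0 : ℂ) else
      Complex.exp (Complex.I * z * t) * evolution H ψ t (n - 1)) (Ioi 0) := by
    split_ifs
    · exact integrableOn_zero
    · exact hint _
  have hHint : IntegrableOn
      (fun t : ℝ => Complex.exp (Complex.I * z * t) * H (evolution H ψ t) n) (Ioi 0) := by
    simp only [hexp]
    exact ((hint _).add hif).add ((hint n).const_mul _)
  have hHeq : ∫ t in Ioi (0 : ℝ), Complex.exp (Complex.I * z * t) * H (evolution H ψ t) n =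
      schrodingerFun V (evolutionTransform H ψ z) n := by
    have hsum : IntegrableOn (fun t : ℝ =>
        Complex.exp (Complex.I * z * t) * evolution H ψ t (n + 1) + (if n = 1 then (0 : ℂ) else
          Complex.exp (Complex.I * z * t) * evolution H ψ t (n - 1))) (Ioi 0) :=
      (hint _).add hif
    simp only [hexp]
    rw [integral_add hsum ((hint n).const_mul _), integral_add (hint _) hif, integral_const_mul]
    unfold schrodingerFun evolutionTransform
    split_ifs <;> simp
  have hderiv : ∀ t : ℝ, HasDerivAt
      (fun t : ℝ => Complex.exp (Complex.I * z * t) * evolution H ψ t n)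
      (Complex.I * z * (Complex.exp (Complex.I * z * t) * evolution H ψ t n) -
        Complex.I * (Complex.exp (Complex.I * z * t) * H (evolution H ψ t) n)) t := by
    intro t
    have h1 : HasDerivAt (fun t : ℝ => Complex.exp (Complex.I * z * t))
        (Complex.exp (Complex.I * z * t) * (Complex.I * z)) t := by
      have := ((hasDerivAt_id (t : ℂ)).const_mul (Complex.I * z)).cexp.comp_ofReal
      simpa using this
    refine (h1.mul (hasDerivAt_evolution_coord H ψ n t)).congr_deriv ?_
    ring
  have hdint := ((hint n).const_mul (Complex.I * z)).sub (hHint.const_mul Complex.I)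
  -- An integrable function with integrable derivative tends to zero, so only the boundary term at
  -- `t = 0` survives.
  have hlim := tendsto_zero_of_hasDerivAt_of_integrableOn_Ioi (a := 0) (fun t _ => hderiv t) hdint
    (hint n)
  have hI := integral_Ioi_of_hasDerivAt_of_tendsto' (a := 0) (fun t _ => hderiv t) hdint hlim
  rw [integral_sub ((hint n).const_mul _) (hHint.const_mul _), integral_const_mul,
    integral_const_mul, hHeq] at hI
  have h0 : evolution H ψ 0 n = ψ n := by simp [evolution, NormedSpace.exp_zero]
  rw [h0] at hI
  change Complex.I * z * evolutionTransform H ψ z n - _ = _ at hI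
  simp only [Complex.ofReal_zero, mul_zero, Complex.exp_zero, one_mul, zero_sub] at hI
  linear_combination Complex.I * hI + (schrodingerFun V (evolutionTransform H ψ z) n -
    z * evolutionTransform H ψ z n) * Complex.I_mul_I

open MeasureTheory Set in
/-- The Cauchy–Schwarz lower bound for the averaged probabilities. -/
theorem ofReal_le_avgProb {H : EllTwo →L[ℂ] EllTwo} (hH : IsSelfAdjoint H) (ψ : EllTwo)
    {z : ℂ} {T : ℝ} (hT : 0 < T) (hz : z.im = 2 / T) (n : ℕ+) :
    ENNReal.ofReal (2 / T ^ 2 * ‖evolutionTransform H ψ z n‖ ^ 2) ≤ avgProb H ψ n T := by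
  set G := ‖evolutionTransform H ψ z n‖ with hG
  set w : ℝ → ℝ := fun t => Real.exp (-(2 / T) * t) with hw
  set f : ℝ → ℝ := fun t => ‖evolution H ψ t n‖ with hf
  have hneg : -(2 / T) < 0 := by have : 0 < 2 / T := by positivity
                                 linarith
  have hwint : IntegrableOn w (Ioi 0) := integrableOn_exp_mul_Ioi hneg 0
  have hwval : ∫ t in Ioi (0 : ℝ), w t = T / 2 := by
    rw [hw, integral_exp_mul_Ioi hneg 0]
    simp
  have hfc : Continuous f := (continuous_evolution_coord H ψ n).norm
  have hwc : Continuous w := by fun_prop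
  have hfb : ∀ t, f t ≤ ‖ψ‖ := norm_evolution_coord_le hH ψ n
  have hf0 : ∀ t, 0 ≤ f t := fun t => norm_nonneg _
  have hw0 : ∀ t, 0 < w t := fun t => Real.exp_pos _
  have h1 : IntegrableOn (fun t => w t * f t) (Ioi 0) := by
    refine Integrable.mono' (hwint.mul_const ‖ψ‖) (hwc.mul hfc).aestronglyMeasurable ?_
    refine Filter.Eventually.of_forall fun t => ?_
    rw [Real.norm_of_nonneg (mul_nonneg (hw0 t).le (hf0 t))]
    exact mul_le_mul_of_nonneg_left (hfb t) (hw0 t).le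
  have h2 : IntegrableOn (fun t => w t * f t ^ 2) (Ioi 0) := by
    refine Integrable.mono' (hwint.mul_const (‖ψ‖ ^ 2)) (hwc.mul (hfc.pow 2)).aestronglyMeasurable ?_
    refine Filter.Eventually.of_forall fun t => ?_
    rw [Real.norm_of_nonneg (mul_nonneg (hw0 t).le (by positivity))]
    exact mul_le_mul_of_nonneg_left (pow_le_pow_left₀ (hf0 t) (hfb t) 2) (hw0 t).le
  have hGle : G ≤ ∫ t in Ioi (0 : ℝ), w t * f t := by
    refine (norm_integral_le_integral_norm _).trans_eq ?_
    refine integral_congr_ae (Filter.Eventually.of_forall fun t => ?_)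
    simp only [norm_mul, norm_exp_I_mul, hz, hw, hf]
  -- Cauchy–Schwarz by expanding `∫ w (f - 2G/T)² ≥ 0`; here `2G/T` is `G` divided by the total mass
  -- `T/2` of `w`.
  have hsq : 0 ≤ ∫ t in Ioi (0 : ℝ), (w t * f t ^ 2 - 4 * G / T * (w t * f t) +
      (2 * G / T) ^ 2 * w t) := by
    refine integral_nonneg fun t => ?_
    have : w t * f t ^ 2 - 4 * G / T * (w t * f t) + (2 * G / T) ^ 2 * w t =
        w t * (f t - 2 * G / T) ^ 2 := by ring
    simp only [this]
    exact mul_nonneg (hw0 t).le (sq_nonneg _)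
  have hsub : IntegrableOn (fun t => w t * f t ^ 2 - 4 * G / T * (w t * f t)) (Ioi 0) :=
    h2.sub (h1.const_mul _)
  rw [integral_add hsub (hwint.const_mul _), integral_sub h2 (h1.const_mul _),
    integral_const_mul, integral_const_mul, hwval] at hsq
  have hG0 : 0 ≤ G := norm_nonneg _
  have hmain : 2 / T * G ^ 2 ≤ ∫ t in Ioi (0 : ℝ), w t * f t ^ 2 := by
    have h3 := mul_le_mul_of_nonneg_left hGle (show 0 ≤ 4 * G / T by positivity)
    have e1 : 4 * G / T * G = 4 / T * G ^ 2 := by ring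
    have e2 : (2 * G / T) ^ 2 * (T / 2) = 2 / T * G ^ 2 := by field_simp
    have e3 : 4 / T * G ^ 2 = 2 / T * G ^ 2 + 2 / T * G ^ 2 := by ring
    linarith
  have hl : ∫⁻ t in Ioi (0 : ℝ), ENNReal.ofReal (Real.exp (-2 * t / T) *
      ‖inner ℂ (delta n) (evolution H ψ t)‖ ^ 2) =
      ENNReal.ofReal (∫ t in Ioi (0 : ℝ), w t * f t ^ 2) := by
    rw [ofReal_integral_eq_lintegral_ofReal h2 (Filter.Eventually.of_forall fun t =>
      mul_nonneg (hw0 t).le (by positivity))]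
    refine lintegral_congr fun t => ?_
    simp only [hw, hf, inner_delta]
    congr 3
    ring
  unfold avgProb
  rw [hl, ← ENNReal.ofReal_mul (by positivity)]
  refine ENNReal.ofReal_le_ofReal ?_
  calc 2 / T ^ 2 * G ^ 2 = 1 / T * (2 / T * G ^ 2) := by ring
    _ ≤ _ := by gcongr

/-! ### The recurrence at energy `a` for the prime potential -/

/-- The transform of the evolution of `δ_1`, extended by the value `i` at the site `0`. -/
noncomputable def extendedTransform (H : EllTwo →L[ℂ] EllTwo) (z : ℂ) (n : ℕ) : ℂ :=
  if h : 0 < n then evolutionTransform H (delta 1) z ⟨n, h⟩ else Complex.I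

theorem extendedTransform_zero (H : EllTwo →L[ℂ] EllTwo) (z : ℂ) :
    extendedTransform H z 0 = Complex.I := rfl

theorem extendedTransform_pnat (H : EllTwo →L[ℂ] EllTwo) (z : ℂ) (n : ℕ+) :
    extendedTransform H z n = evolutionTransform H (delta 1) z n := by
  rw [extendedTransform, dif_pos n.pos]
  rfl

/-- The value `i` at site `0` absorbs the source term `-i δ_1`, making the resolvent equation
homogeneous at site `1` too. -/
theorem extendedTransform_recurrence (V : ℕ → ℝ) (hV : ∃ C : ℝ, ∀ n : ℕ+, |V n| ≤ C) {z : ℂ}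
    (hz : 0 < z.im) (n : ℕ) :
    let g := extendedTransform (schrodinger (fun n : ℕ+ => V n) hV) z
    g (n + 2) + g n = (z - V (n + 1)) * g (n + 1) := by
  intro g
  have h := schrodingerFun_evolutionTransform (fun n : ℕ+ => V n) hV (delta 1) hz n.succPNat
  have e1 : g (n + 1) = evolutionTransform (schrodinger (fun n : ℕ+ => V n) hV) (delta 1) z
      n.succPNat := extendedTransform_pnat _ _ n.succPNat
  have e2 : g (n + 2) = evolutionTransform (schrodinger (fun n : ℕ+ => V n) hV) (delta 1) z
      (n.succPNat + 1) := extendedTransform_pnat _ _ (n.succPNat + 1)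
  unfold schrodingerFun at h
  rw [← e1, ← e2] at h
  simp only [Nat.succPNat_coe, Nat.succ_eq_add_one] at h
  rcases Nat.eq_zero_or_pos n with rfl | hn
  · have e0 : g 0 = Complex.I := rfl
    have hd : delta 1 (Nat.succPNat 0) = 1 := by
      change (delta 1) 1 = 1
      simp [delta]
    rw [hd, if_pos (show Nat.succPNat 0 = 1 from rfl)] at h
    rw [e0]
    linear_combination h
  · have hne : n.succPNat ≠ 1 := by
      intro h
      have := congrArg PNat.val h
      simp at this
      omega
    have hd : delta 1 n.succPNat = 0 := by
      simp [delta, hne]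
    have hs : n.succPNat - 1 = ⟨n, hn⟩ := PNat.add_sub (a := ⟨n, hn⟩) (b := 1)
    have e0 : g n = evolutionTransform (schrodinger (fun n : ℕ+ => V n) hV) (delta 1) z ⟨n, hn⟩ :=
      extendedTransform_pnat _ _ ⟨n, hn⟩
    rw [hd, if_neg hne, hs, ← e0] at h
    linear_combination h

/-- The transform of `δ_1` under the prime Schrödinger operator decays at most linearly up to
distance of order `√T`. -/
theorem one_le_extendedTransform_prime (a b : ℝ) {N T : ℝ} (hN : 1 ≤ N) (hT : 1 ≤ T)
    (hNT : N ^ 2 ≤ 4 * T) {n : ℕ} (hn : 2 ≤ n) (hnN : n ≤ 2 * N) :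
    let g := extendedTransform (primeSchrodinger a b) (a + (2 / T : ℝ) * Complex.I)
    1 ≤ (1 + (|a - b| + 8)) ^ 2 * Real.exp (2 * (|a - b| + 8)) *
      (N * (‖g n‖ + ‖g (n + 1)‖)) := by
  intro g
  have hT0 : 0 < T := by linarith
  set z : ℂ := a + (2 / T : ℝ) * Complex.I with hz
  have hzim : z.im = 2 / T := by simp [hz]
  have hz0 : 0 < z.im := by rw [hzim]; positivity
  set V : ℕ → ℝ := fun n => if n.Prime then b else a with hV
  have hη : ‖((2 / T : ℝ) : ℂ) * Complex.I‖ = 2 / T := by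
    rw [norm_mul, Complex.norm_I, mul_one, Complex.norm_real, Real.norm_of_nonneg (by positivity)]
  have hη8 : 2 / T ≤ 8 := by rw [div_le_iff₀ hT0]; linarith
  -- The `8` is `(2/T) * 4T`; it also dominates the imaginary part `2/T` at prime sites.
  have hηN : 2 / T * N ^ 2 ≤ |a - b| + 8 := by
    have : 2 / T * N ^ 2 ≤ 2 / T * (4 * T) := by gcongr
    have e : 2 / T * (4 * T) = 8 := by field_simp; norm_num
    linarith [abs_nonneg (a - b)]
  have hnp : ∀ n : ℕ, ¬ n.Prime → ‖z - V n‖ ≤ 2 / T := by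
    intro n hp
    rw [hV]
    simp only [hp, if_false]
    rw [hz, add_sub_cancel_left, hη]
  have hrec : ∀ n, g (n + 2) + g n = (z - V (n + 1)) * g (n + 1) := fun n =>
    extendedTransform_recurrence V (primePotential_bounded a b) hz0 n
  have := norm_le_of_parity_recurrence (c := fun n => z - V n) hN hηN hrec ?_ ?_ hn hnN
  · simpa [g, extendedTransform_zero] using this
  · intro n
    by_cases hp : n.Prime
    · simp only [hV, hp, if_true]
      have e : z - b = ((a - b : ℝ) : ℂ) + (2 / T : ℝ) * Complex.I := by
        rw [hz]; push_cast; ring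
      rw [e]
      refine (norm_add_le _ _).trans ?_
      rw [hη, Complex.norm_real, Real.norm_eq_abs]
      linarith
    · linarith [hnp n hp, abs_nonneg (a - b)]
  · intro n hn2 he
    exact hnp n fun hp => by
      rcases hp.eq_two_or_odd' with h | h
      · omega
      · exact (Nat.not_even_iff_odd.2 h) he

/-! ### Lower bounds for the moment and its growth exponent -/

theorem sum_range_le_tsum_pnat (F : ℕ+ → ℝ≥0∞) (m : ℕ) (hm : 0 < m) (N : ℕ) :
    ∑ k ∈ Finset.range N, F ⟨m + k, by omega⟩ ≤ ∑' n, F n := by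
  refine le_trans (ENNReal.sum_le_tsum _) (ENNReal.tsum_comp_le_tsum_of_injective
    (f := fun k : ℕ => (⟨m + k, by omega⟩ : ℕ+)) ?_ F)
  intro i j h
  have := congrArg PNat.val h
  simpa using this

theorem ofReal_le_avgMoment {H : EllTwo →L[ℂ] EllTwo} (hH : IsSelfAdjoint H) {z : ℂ} {p T D : ℝ}
    (hp : 0 < p) (hT : 0 < T) (hz : z.im = 2 / T) {N : ℕ} (hN : 0 < N) (hD : 0 < D)
    (h : ∀ n : ℕ, N ≤ n → n < 2 * N →
      1 ≤ D * (N * (‖extendedTransform H z n‖ + ‖extendedTransform H z (n + 1)‖))) :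
    ENNReal.ofReal ((N : ℝ) ^ p / (2 * T ^ 2 * D ^ 2 * N)) ≤ avgMoment H (delta 1) p T := by
  set g := extendedTransform H z with hg
  set M := avgMoment H (delta 1) p T with hM
  have hN0 : (0 : ℝ) < N := by exact_mod_cast hN
  have hterm : ∀ n : ℕ, ∀ hn : N ≤ n, ENNReal.ofReal ((N : ℝ) ^ p * (2 / T ^ 2 * ‖g n‖ ^ 2)) ≤
      ENNReal.ofReal (((⟨n, by omega⟩ : ℕ+) : ℝ) ^ p) * avgProb H (delta 1) ⟨n, by omega⟩ T := by
    intro n hn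
    rw [ENNReal.ofReal_mul (by positivity)]
    gcongr
    have := ofReal_le_avgProb hH (delta 1) hT hz ⟨n, by omega⟩
    have e : g n = evolutionTransform H (delta 1) z ⟨n, by omega⟩ :=
      extendedTransform_pnat H z ⟨n, by omega⟩
    rwa [e]
  have hsum : ∀ m : ℕ, N ≤ m → ENNReal.ofReal (∑ k ∈ Finset.range N,
      (N : ℝ) ^ p * (2 / T ^ 2 * ‖g (m + k)‖ ^ 2)) ≤ M := by
    intro m hm
    rw [ENNReal.ofReal_sum_of_nonneg (fun _ _ => by positivity)]
    refine le_trans (Finset.sum_le_sum fun k _ => hterm (m + k) (by omega)) ?_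
    exact sum_range_le_tsum_pnat
      (fun n => ENNReal.ofReal ((n : ℝ) ^ p) * avgProb H (delta 1) n T) m (by omega) N
  -- Only the pair `n`, `n + 1` is bounded below, so windows starting at `N` and `N + 1` are added;
  -- each is at most `M`, whence the `2` in the denominator of the conclusion.
  have hpair : ∀ k ∈ Finset.range N, (N : ℝ) ^ p / (T ^ 2 * D ^ 2 * N ^ 2) ≤
      (N : ℝ) ^ p * (2 / T ^ 2 * ‖g (N + k)‖ ^ 2) +
        (N : ℝ) ^ p * (2 / T ^ 2 * ‖g (N + 1 + k)‖ ^ 2) := by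
    intro k hk
    have hk' := Finset.mem_range.1 hk
    have h1 := h (N + k) (by omega) (by omega)
    rw [show N + k + 1 = N + 1 + k by ring] at h1
    set x := ‖g (N + k)‖
    set y := ‖g (N + 1 + k)‖
    have h2 : 1 ≤ (D * (N * (x + y))) ^ 2 := one_le_pow₀ h1
    have h3 : 1 / (D ^ 2 * N ^ 2) ≤ 2 * (x ^ 2 + y ^ 2) := by
      rw [div_le_iff₀ (by positivity)]
      have : (x + y) ^ 2 ≤ 2 * (x ^ 2 + y ^ 2) := by nlinarith [sq_nonneg (x - y)]
      calc 1 ≤ (x + y) ^ 2 * (D ^ 2 * N ^ 2) := by linarith [h2]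
        _ ≤ _ := by gcongr
    calc (N : ℝ) ^ p / (T ^ 2 * D ^ 2 * N ^ 2)
        = (N : ℝ) ^ p / T ^ 2 * (1 / (D ^ 2 * N ^ 2)) := by field_simp
      _ ≤ (N : ℝ) ^ p / T ^ 2 * (2 * (x ^ 2 + y ^ 2)) := by gcongr
      _ = _ := by ring
  have hle := Finset.sum_le_sum hpair
  rw [Finset.sum_const, Finset.card_range, nsmul_eq_mul, Finset.sum_add_distrib] at hle
  rcases eq_or_ne M ⊤ with hMt | hMt
  · rw [hMt]; exact le_top
  · rw [ENNReal.ofReal_le_iff_le_toReal hMt]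
    have h1 := (ENNReal.ofReal_le_iff_le_toReal hMt).1 (hsum N le_rfl)
    have h2 := (ENNReal.ofReal_le_iff_le_toReal hMt).1 (hsum (N + 1) (by omega))
    have e : (N : ℝ) * ((N : ℝ) ^ p / (T ^ 2 * D ^ 2 * N ^ 2)) =
        2 * ((N : ℝ) ^ p / (2 * T ^ 2 * D ^ 2 * N)) := by
      field_simp
    linarith

/-- The constant contributes only `log c / log T`, which tends to zero. -/
theorem le_liminf_log_div_log {f : ℝ → ℝ≥0∞} {c s : ℝ} (hc : 0 < c)
    (h : ∀ᶠ T : ℝ in Filter.atTop, ENNReal.ofReal (c * T ^ s) ≤ f T) :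
    (s : EReal) ≤
      Filter.liminf (fun T : ℝ => ENNReal.log (f T) / (Real.log T : EReal)) Filter.atTop := by
  have hlim : Filter.Tendsto (fun T : ℝ => (((Real.log c / Real.log T + s : ℝ)) : EReal))
      Filter.atTop (nhds (s : EReal)) := by
    refine (continuous_coe_real_ereal.tendsto s).comp ?_
    have := (Real.tendsto_log_atTop.const_div_atTop (Real.log c)).add_const s
    simpa using this
  rw [← hlim.liminf_eq]
  refine Filter.liminf_le_liminf ?_
  filter_upwards [h, Filter.eventually_gt_atTop 1] with T hT hT1
  have hT0 : 0 < T := by linarith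
  have hlog : 0 < Real.log T := Real.log_pos hT1
  have e : Real.log c / Real.log T + s = Real.log (c * T ^ s) / Real.log T := by
    rw [Real.log_mul hc.ne' (by positivity), Real.log_rpow hT0]
    field_simp
  rw [e, EReal.coe_div, ← ENNReal.log_ofReal_of_pos (by positivity)]
  exact EReal.div_le_div_right_of_nonneg (by exact_mod_cast hlog.le) (ENNReal.log_le_log hT)

theorem corollary4p7 (a b : ℝ) (p : ℝ) (hp : 0 < p) :
    (((p - 5) / 2 : ℝ) : EReal) ≤ lowerGrowthExponent (primeSchrodinger a b) (delta 1) p := by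
  set D : ℝ := (1 + (|a - b| + 8)) ^ 2 * Real.exp (2 * (|a - b| + 8)) with hD
  have hD0 : 0 < D := by positivity
  refine le_liminf_log_div_log (c := 1 / (4 * D ^ 2)) (by positivity) ?_
  -- `T ≥ 4` gives `√T ≥ 2`, hence `N ≥ 2`, where the recurrence bound starts, and `⌈√T⌉₊ ≤ 2√T`.
  filter_upwards [Filter.eventually_ge_atTop 4] with T hT
  have hT0 : 0 < T := by linarith
  have hsq : √T ^ 2 = T := Real.sq_sqrt hT0.le
  have hs2 : 2 ≤ √T := Real.le_sqrt_of_sq_le (by linarith)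
  set N : ℕ := ⌈√T⌉₊ with hN
  have hNs : √T ≤ N := Nat.le_ceil _
  have hNs2 : (N : ℝ) ≤ 2 * √T := by
    have := Nat.ceil_lt_add_one (Real.sqrt_nonneg T)
    linarith
  have hN2 : 2 ≤ N := by exact_mod_cast hs2.trans hNs
  have hN0 : (0 : ℝ) < N := by linarith
  have hNT : (N : ℝ) ^ 2 ≤ 4 * T := by nlinarith
  refine le_trans (ENNReal.ofReal_le_ofReal ?_) (ofReal_le_avgMoment (N := N) (D := D)
    (z := a + (2 / T : ℝ) * Complex.I) (isSelfAdjoint_schrodinger _ _) hp hT0 ?_ (by omega) hD0 ?_)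
  · have hpow : T ^ ((p - 5) / 2) = √T ^ p / (T ^ 2 * √T) := by
      rw [Real.sqrt_eq_rpow, ← Real.rpow_mul hT0.le, ← Real.rpow_natCast T 2,
        ← Real.rpow_add hT0, ← Real.rpow_sub hT0]
      congr 1
      push_cast
      ring
    rw [hpow]
    calc 1 / (4 * D ^ 2) * (√T ^ p / (T ^ 2 * √T))
        = √T ^ p / (2 * T ^ 2 * D ^ 2 * (2 * √T)) := by field_simp; norm_num
      _ ≤ (N : ℝ) ^ p / (2 * T ^ 2 * D ^ 2 * N) := by gcongr
  · simp
  · intro n hn hn2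
    exact one_le_extendedTransform_prime a b (by linarith) (by linarith) hNT (by omega)
      (by exact_mod_cast hn2.le)
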